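/- Let $X$ be a Gaussian random vector in $\mathbb{R}^L$ with mean $0$ and positive definite covariance matrix $\Sigma_X=\Theta^T\,\mathrm{diag}(\lambda_1,\dots,\lambda_L)\,\Theta$, where $\Theta$ is a real orthogonal matrix. For $D\in[0,\infty)$ and $P\in[0,\infty]$ let $$R(D,P)=\inf I(X;\hat X),$$ where the infimum is over all conditional distributions $P_{\hat X|X}$ of a random vector $\hat X$ in $\mathbb{R}^L$ given $X$ such that $\mathbb{E}\|X-\hat X\|^2\le D$ and $D_{\mathrm{KL}}(P_{\hat X}\,\|\,P_X)\le P$; here $I$ is the mutual information, all logarithms are natural, and $\inf\emptyset=+\infty$. Then $$R(D,P)=\min_{\{\gamma_\ell,\hat\lambda_\ell\}_{\ell=1}^L}\ \frac12\sum_{\ell=1}^L\log\frac{\lambda_\ell}{\gamma_\ell},$$ where the minimum is over all real numbers $\gamma_\ell,\hat\lambda_\ell$ with $0<\gamma_\ell\le\lambda_\ell$ and $\hat\lambda_\ell\ge 0$ for $\ell=1,\dots,L$, subject to $$\sum_{\ell=1}^L\Bigl(\lambda_\ell-2\sqrt{\hat\lambda_\ell(\lambda_\ell-\gamma_\ell)}+\hat\lambda_\ell\Bigr)\le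 D,\qquad \frac12\sum_{\ell=1}^L\Bigl(\frac{\hat\lambda_\ell}{\lambda_\ell}-1+\log\frac{\lambda_\ell}{\hat\lambda_\ell}\Bigr)\le P,$$ with the convention $\log(\lambda_\ell/0)=+\infty$. The constraints can be satisfied whenever $D>0$, and the minimum is attained whenever they can be satisfied; if they cannot be satisfied, then $R(D,P)=+\infty$. -/

import Mathlib

open MeasureTheory ProbabilityTheory InformationTheory
open scoped ENNReal NNReal Matrix

noncomputable section

namespace RDP

/-- Mutual information (in nats) of a pair of random variables with joint law `π`:
the Kullback-Leibler divergence of `π` from the product of its marginals. -/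
def mutualInfo {E F : Type*} [MeasurableSpace E] [MeasurableSpace F] (π : Measure (E × F)) :
    ℝ≥0∞ :=
  klDiv π (π.fst.prod π.snd)

/-- The conditional laws `κ` of a reconstruction given the source (Markov kernels on `ℝ^L`)
such that the expected squared Euclidean error between the source `X` of law `PX` and its
reconstruction is at most `D`, and the divergence of the law of the reconstruction
from the law of the source is at most `P`. -/
def admissible {L : ℕ} (PX : Measure (EuclideanSpace ℝ (Fin L))) (D : ℝ≥0) (P : ℝ≥0∞) :
    Set (Kernel (EuclideanSpace ℝ (Fin L)) (EuclideanSpace ℝ (Fin L))) :=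
  {κ | IsMarkovKernel κ ∧
    ∫⁻ p, ‖p.1 - p.2‖ₑ ^ 2 ∂(PX ⊗ₘ κ) ≤ (D : ℝ≥0∞) ∧
    klDiv (κ ∘ₘ PX) PX ≤ P}

/-- The (information) rate-distortion-perception function of a source of law `PX`, with
squared-error distortion and Kullback-Leibler perception loss. It is `∞` if no conditional law
satisfies the constraints. -/
def rdpFunction {L : ℕ} (PX : Measure (EuclideanSpace ℝ (Fin L))) (D : ℝ≥0) (P : ℝ≥0∞) :
    ℝ≥0∞ :=
  ⨅ κ ∈ admissible PX D P, mutualInfo (PX ⊗ₘ κ)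

/-- The distortion of one component of variance `lam`. -/
def distLoss (lam gam lamHat : ℝ) : ℝ :=
  lam - 2 * √(lamHat * (lam - gam)) + lamHat

/-- The perception loss of one component of variance `lam`; `log (lam / 0)` is `+∞`. -/
def percLoss (lam lamHat : ℝ) : EReal :=
  if lamHat = 0 then ⊤
  else ((1 / 2 * (lamHat / lam - 1 + Real.log (lam / lamHat)) : ℝ) : EReal)

/-- The feasible points `(γ, λ̂)` of the optimization program. -/
def feasible {L : ℕ} (lam : Fin L → ℝ) (D : ℝ≥0) (P : ℝ≥0∞) :
    Set ((Fin L → ℝ) × (Fin L → ℝ)) :=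
  {q | (∀ l, 0 < q.1 l ∧ q.1 l ≤ lam l) ∧ (∀ l, 0 ≤ q.2 l) ∧
    ∑ l, distLoss (lam l) (q.1 l) (q.2 l) ≤ (D : ℝ) ∧
    ∑ l, percLoss (lam l) (q.2 l) ≤ (P : EReal)}

/-- The objective of the optimization program. -/
def rate {L : ℕ} (lam : Fin L → ℝ) (q : (Fin L → ℝ) × (Fin L → ℝ)) : ℝ :=
  1 / 2 * ∑ l, Real.log (lam l / q.1 l)

end RDP

end

/-! Converse. By Fenchel-Young duality, `klDiv π ρ` is at least the integral of `f` under `π`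
whenever `exp f` has `ρ`-integral at most 1. In the eigenbasis of the covariance, take for `f` the
log-density, relative to the source, of independent normals N(m l y, v l)
(`ofReal_sum_le_klDiv_prod`). With the best affine estimate of X l from Y l as the mean and its
error γ l as v l, the bound on the mutual information is exactly `rate`. With the mean of Y l, which
is a constant, and the variance λ̂ l of Y l, the same test function bounds the perception loss
(`ofReal_sum_le_klDiv`). Since λ̂ (λ - γ) is the squared covariance of X l and Y l, `distLoss` is at
most the actual distortion (`exists_affine_estimate`). So every coupling of finite information
yields a feasible point of no larger rate, with no independence between the components and no
conditional expectations.

Achievability. Independent backward channels X = b Y + N with Gaussian Y and N realize a feasible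
point (`exists_scalar_coupling`, `exists_coupling_of_feasible`). Data processing carries both halves
through the rotation Θ.

Attainment. Feasible points of bounded rate lie in a compact box on which the constraints are closed
and the rate is continuous. -/

namespace RDP

/-! ### Duality and density formulas for the divergence -/

lemma mul_le_klFun_sub_one_add_exp {r : ℝ} (hr : 0 ≤ r) (t : ℝ) :
    r * t ≤ klFun r - 1 + Real.exp t := by
  rw [klFun_apply]
  rcases hr.eq_or_lt with rfl | hr
  · simp [Real.exp_nonneg]
  -- Fenchel-Young for r log r: this is 1 + s ≤ exp s at s = t - log r, multiplied by r.
  · have h := Real.add_one_le_exp (t - Real.log r)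
    rw [Real.exp_sub, Real.exp_log hr, le_div_iff₀ hr] at h
    nlinarith

/-- The variational lower bound on the Kullback-Leibler divergence. -/
lemma ofReal_integral_le_klDiv {α : Type*} [MeasurableSpace α] {π ρ : Measure α}
    [IsProbabilityMeasure π] [IsProbabilityMeasure ρ] {f : α → ℝ} (hf : Measurable f)
    (hfint : Integrable f π) (hexp : ∫⁻ x, ENNReal.ofReal (Real.exp (f x)) ∂ρ ≤ 1) :
    ENNReal.ofReal (∫ x, f x ∂π) ≤ klDiv π ρ := by
  by_cases htop : klDiv π ρ = ⊤
  · simp [htop]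
  obtain ⟨hac, hint⟩ := klDiv_ne_top_iff.1 htop
  have hexp_int : Integrable (fun x ↦ Real.exp (f x)) ρ := by
    refine ⟨by fun_prop, ?_⟩
    rw [hasFiniteIntegral_iff_ofReal (ae_of_all _ fun x ↦ (Real.exp_pos _).le)]
    exact hexp.trans_lt ENNReal.one_lt_top
  have hexp_le : ∫ x, Real.exp (f x) ∂ρ ≤ 1 := by
    rw [integral_eq_lintegral_of_nonneg_ae (ae_of_all _ fun x ↦ (Real.exp_pos _).le) (by fun_prop)]
    exact ENNReal.toReal_le_of_le_ofReal zero_le_one (by simpa using hexp)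
  have hkl := (integrable_klFun_rnDeriv_iff hac).2 hint
  rw [← ENNReal.ofReal_toReal htop, toReal_klDiv_eq_integral_klFun hac,
    ← integral_rnDeriv_smul hac]
  apply ENNReal.ofReal_le_ofReal
  -- The pointwise inequality is integrated against ρ; the mass of `exp ∘ f`, at most 1, is absorbed
  -- by the constant -1.
  have h1 : ∫ x, (π.rnDeriv ρ x).toReal • f x ∂ρ ≤
      ∫ x, (klFun (π.rnDeriv ρ x).toReal - 1 + Real.exp (f x)) ∂ρ := by
    refine integral_mono ((integrable_rnDeriv_smul_iff hac).2 hfint)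
      ((hkl.sub (integrable_const 1)).add hexp_int) fun x ↦ ?_
    simpa using mul_le_klFun_sub_one_add_exp ENNReal.toReal_nonneg (f x)
  rw [integral_add (f := fun x ↦ klFun (π.rnDeriv ρ x).toReal - 1)
    (hkl.sub (integrable_const 1)) hexp_int, integral_sub hkl (integrable_const 1)] at h1
  simp only [integral_const, probReal_univ, smul_eq_mul, mul_one] at h1 ⊢
  linarith

lemma klDiv_withDensity_exp {α : Type*} [MeasurableSpace α] {π ρ : Measure α}
    [IsProbabilityMeasure π] [IsProbabilityMeasure ρ] {f : α → ℝ} (hf : Measurable f)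
    (hfint : Integrable f π)
    (h : π = ρ.withDensity fun x ↦ ENNReal.ofReal (Real.exp (f x))) :
    klDiv π ρ = ENNReal.ofReal (∫ x, f x ∂π) := by
  have hac : π ≪ ρ := h ▸ withDensity_absolutelyContinuous _ _
  have hd : π.rnDeriv ρ =ᵐ[π] fun x ↦ ENNReal.ofReal (Real.exp (f x)) := by
    apply hac.ae_eq
    conv_lhs => rw [h]
    exact Measure.rnDeriv_withDensity ρ (by fun_prop)
  have hllr : llr π ρ =ᵐ[π] f := by
    filter_upwards [hd] with x hx
    rw [llr, hx, ENNReal.toReal_ofReal (Real.exp_pos _).le, Real.log_exp]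
  rw [klDiv_of_ac_of_integrable hac (hfint.congr hllr.symm), integral_congr_ae hllr]
  simp

/-! ### Densities and divergence of product measures -/

section Pi

variable {ι : Type*} [Fintype ι] {α : ι → Type*} [∀ i, MeasurableSpace (α i)]

lemma lintegral_pi_prod (μ : ∀ i, Measure (α i)) [∀ i, IsProbabilityMeasure (μ i)]
    {f : ∀ i, α i → ℝ≥0∞} (hf : ∀ i, Measurable (f i)) :
    ∫⁻ x, ∏ i, f i (x i) ∂(Measure.pi μ) = ∏ i, ∫⁻ x, f i x ∂(μ i) := by
  rw [lintegral_prod_eq_prod_lintegral_of_indepFun (μ := Measure.pi μ) Finset.univ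
    (fun i x ↦ f i (x i)) (iIndepFun_pi fun i ↦ (hf i).aemeasurable) fun i ↦ by fun_prop]
  exact Finset.prod_congr rfl fun i _ ↦
    (measurePreserving_eval μ i).lintegral_comp (hf i)

lemma pi_withDensity (μ : ∀ i, Measure (α i)) [∀ i, IsProbabilityMeasure (μ i)]
    {f : ∀ i, α i → ℝ≥0∞} (hf : ∀ i, Measurable (f i))
    [∀ i, SigmaFinite ((μ i).withDensity (f i))] :
    Measure.pi (fun i ↦ (μ i).withDensity (f i)) =
      (Measure.pi μ).withDensity fun x ↦ ∏ i, f i (x i) := by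
  refine Measure.pi_eq fun s hs ↦ ?_
  rw [withDensity_apply _ (.univ_pi hs), ← lintegral_indicator (.univ_pi hs)]
  have : (Set.univ.pi s).indicator (fun x ↦ ∏ i, f i (x i)) =
      fun x ↦ ∏ i, (s i).indicator (f i) (x i) := by
    ext x
    classical
    simp only [Set.indicator_apply, Set.mem_univ_pi]
    rw [Finset.prod_ite_zero]
    simp
  rw [this, lintegral_pi_prod μ fun i ↦ (hf i).indicator (hs i)]
  refine Finset.prod_congr rfl fun i _ ↦ ?_
  rw [lintegral_indicator (hs i), withDensity_apply _ (hs i)]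

/-- The divergence of a product measure from a product measure with respect to which each factor
has a density. -/
lemma klDiv_pi_withDensity_exp (π ρ : ∀ i, Measure (α i)) [∀ i, IsProbabilityMeasure (π i)]
    [∀ i, IsProbabilityMeasure (ρ i)] {f : ∀ i, α i → ℝ} (hf : ∀ i, Measurable (f i))
    (hfint : ∀ i, Integrable (f i) (π i))
    (h : ∀ i, π i = (ρ i).withDensity fun x ↦ ENNReal.ofReal (Real.exp (f i x))) :
    klDiv (Measure.pi π) (Measure.pi ρ) = ENNReal.ofReal (∑ i, ∫ x, f i x ∂(π i)) := by
  have hint (i : ι) : Integrable (fun x : ∀ i, α i ↦ f i (x i)) (Measure.pi π) :=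
    (measurePreserving_eval π i).integrable_comp_of_integrable (hfint i)
  have hm : Measurable fun x : ∀ i, α i ↦ ∑ i, f i (x i) :=
    Finset.measurable_sum _ fun i _ ↦ (hf i).comp (measurable_pi_apply i)
  rw [klDiv_withDensity_exp (f := fun x ↦ ∑ i, f i (x i)) hm
    (integrable_finsetSum _ fun i _ ↦ hint i), integral_finsetSum _ fun i _ ↦ hint i]
  · congr 1
    refine Finset.sum_congr rfl fun i _ ↦ ?_
    rw [← (measurePreserving_eval π i).map_eq, integral_map (measurable_pi_apply i).aemeasurable]
    exact (hf i).aestronglyMeasurable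
  · have (i : ι) : IsProbabilityMeasure
        ((ρ i).withDensity fun x ↦ ENNReal.ofReal (Real.exp (f i x))) := h i ▸ inferInstance
    rw [funext h, pi_withDensity ρ fun i ↦ by fun_prop]
    simp_rw [Real.exp_sum, ENNReal.ofReal_prod_of_nonneg fun i _ ↦ (Real.exp_pos _).le]

end Pi

/-! ### Gaussian likelihood ratios and the perception constraint -/

/-- The log-likelihood ratio at `x` of `N(m, v)` with respect to `N(0, lam)`. -/
noncomputable def gaussLLR (lam v m x : ℝ) : ℝ :=
  1 / 2 * Real.log (lam / v) - (x - m) ^ 2 / (2 * v) + x ^ 2 / (2 * lam)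

lemma gaussianReal_eq_withDensity {lam v : ℝ≥0} (hl : lam ≠ 0) (hv : v ≠ 0) (m : ℝ) :
    gaussianReal m v = (gaussianReal 0 lam).withDensity
      fun x ↦ ENNReal.ofReal (Real.exp (gaussLLR lam v m x)) := by
  rw [gaussianReal_of_var_ne_zero _ hl, gaussianReal_of_var_ne_zero _ hv,
    ← withDensity_mul _ (measurable_gaussianPDF _ _) (by unfold gaussLLR; fun_prop)]
  congr 1
  ext x
  rw [Pi.mul_apply, gaussianPDF, gaussianPDF, ← ENNReal.ofReal_mul (gaussianPDFReal_nonneg _ _ _)]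
  congr 1
  have hl' : (0 : ℝ) < lam := by positivity
  have hv' : (0 : ℝ) < v := by positivity
  have h1 : Real.exp (1 / 2 * Real.log (lam / v)) = √lam / √v := by
    rw [← Real.sqrt_div hl'.le, Real.sqrt_eq_rpow, Real.rpow_def_of_pos (by positivity), mul_comm]
  have h2 : gaussLLR lam v m x = 1 / 2 * Real.log (lam / v) +
      (-(x - m) ^ 2 / (2 * v) + x ^ 2 / (2 * lam)) := by
    unfold gaussLLR; ring
  have h3 : Real.exp (-(x - m) ^ 2 / (2 * v)) = Real.exp (-(x - 0) ^ 2 / (2 * lam)) *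
      Real.exp (-(x - m) ^ 2 / (2 * v) + x ^ 2 / (2 * lam)) := by
    rw [← Real.exp_add]; congr 1; ring
  rw [gaussianPDFReal, gaussianPDFReal, h2, Real.exp_add, h1, h3,
    Real.sqrt_mul (by positivity) (lam : ℝ), Real.sqrt_mul (by positivity) (v : ℝ)]
  have := Real.sqrt_pos.2 hl'
  have := Real.sqrt_pos.2 hv'
  generalize √(2 * Real.pi) = c
  field_simp

lemma lintegral_exp_gaussLLR {lam v : ℝ≥0} (hl : lam ≠ 0) (hv : v ≠ 0) (m : ℝ) :
    ∫⁻ x, ENNReal.ofReal (Real.exp (gaussLLR lam v m x)) ∂(gaussianReal 0 lam) = 1 := by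
  have h := congrArg (fun μ ↦ μ Set.univ) (gaussianReal_eq_withDensity hl hv m)
  simpa using h.symm

lemma lintegral_exp_sum_gaussLLR {ι : Type*} [Fintype ι] {lam v : ι → ℝ≥0} (hl : ∀ i, lam i ≠ 0)
    (hv : ∀ i, v i ≠ 0) (m : ι → ℝ) :
    ∫⁻ x, ENNReal.ofReal (Real.exp (∑ i, gaussLLR (lam i) (v i) (m i) (x i)))
      ∂(Measure.pi fun i ↦ gaussianReal 0 (lam i)) = 1 := by
  simp_rw [Real.exp_sum, ENNReal.ofReal_prod_of_nonneg fun i _ ↦ (Real.exp_pos _).le]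
  rw [lintegral_pi_prod (fun i ↦ gaussianReal 0 (lam i))
    (f := fun i x ↦ ENNReal.ofReal (Real.exp (gaussLLR (lam i) (v i) (m i) x)))
    fun i ↦ by unfold gaussLLR; fun_prop]
  simp [lintegral_exp_gaussLLR (hl _) (hv _)]

lemma enorm_sq_eq_ofReal_sq (x : ℝ) : ‖x‖ₑ ^ 2 = ENNReal.ofReal (x ^ 2) := by
  rw [← sq_abs, ENNReal.ofReal_pow (abs_nonneg _), ← Real.enorm_eq_ofReal_abs]

lemma ereal_coe_sum {ι : Type*} (s : Finset ι) (f : ι → ℝ) :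
    ((∑ i ∈ s, f i : ℝ) : EReal) = ∑ i ∈ s, (f i : EReal) := by
  classical
  induction s using Finset.induction_on with
  | empty => simp
  | insert i s hi ih => rw [Finset.sum_insert hi, Finset.sum_insert hi, EReal.coe_add, ih]

lemma percLoss_nonneg {lam lamHat : ℝ} (hl : 0 < lam) (hh : 0 ≤ lamHat) :
    0 ≤ percLoss lam lamHat := by
  rw [percLoss]
  split_ifs with h
  · exact le_top
  · have h0 := Real.log_le_sub_one_of_pos (div_pos (hh.lt_of_ne' h) hl)
    rw [← inv_div, Real.log_inv] at h0
    rw [inv_div] at h0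
    norm_cast
    linarith

/-- Each summand is nonnegative, so a single `⊤` cannot be cancelled and a finite P forces every λ̂
to be positive. The constraint is then one between real numbers. -/
lemma sum_percLoss_le_iff {ι : Type*} [Fintype ι] {lam lamHat : ι → ℝ} (hl : ∀ i, 0 < lam i)
    (hh : ∀ i, 0 ≤ lamHat i) {P : ℝ≥0∞} (hP : P ≠ ⊤) :
    ∑ i, percLoss (lam i) (lamHat i) ≤ (P : EReal) ↔ (∀ i, 0 < lamHat i) ∧
      ∑ i, 1 / 2 * (lamHat i / lam i - 1 + Real.log (lam i / lamHat i)) ≤ P.toReal := by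
  have main (hpos : ∀ i, 0 < lamHat i) : ∑ i, percLoss (lam i) (lamHat i) ≤ (P : EReal) ↔
      ∑ i, 1 / 2 * (lamHat i / lam i - 1 + Real.log (lam i / lamHat i)) ≤ P.toReal := by
    simp only [percLoss, (hpos _).ne', if_false]
    rw [← ereal_coe_sum, ← EReal.coe_le_coe_iff]
    conv_lhs => rw [← ENNReal.ofReal_toReal hP]
    rw [EReal.coe_ennreal_ofReal, max_eq_left ENNReal.toReal_nonneg]
  refine ⟨fun h ↦ ?_, fun h ↦ (main h.1).2 h.2⟩
  have hpos (i : ι) : 0 < lamHat i := by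
    refine (hh i).lt_of_ne' fun h0 ↦ ?_
    have := (Finset.single_le_sum (fun i _ ↦ percLoss_nonneg (hl i) (hh i))
      (Finset.mem_univ i)).trans h
    simp [percLoss, h0, hP] at this
  exact ⟨hpos, (main hpos).1 h⟩

lemma integral_sq_gaussianReal (v : ℝ≥0) : ∫ x, x ^ 2 ∂(gaussianReal 0 v) = v := by
  have h := variance_fun_id_gaussianReal (μ := 0) (v := v)
  rw [variance_eq_integral measurable_id'.aemeasurable] at h
  simpa using h

/-! ### Converse: from a coupling to a feasible point -/

/-- The best affine estimate of `X` from `Y`, with its error and the variance of `Y`. -/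
lemma exists_affine_estimate {Ω : Type*} [MeasurableSpace Ω] {μ : Measure Ω}
    [IsProbabilityMeasure μ] {X Y : Ω → ℝ} (hX : MemLp X 2 μ) (hY : MemLp Y 2 μ)
    (hX0 : ∫ ω, X ω ∂μ = 0) :
    ∃ p b : ℝ, ∫ ω, (X ω - b * (Y ω - p)) ^ 2 ∂μ ≤ ∫ ω, X ω ^ 2 ∂μ ∧
      ∫ ω, (Y ω - p) ^ 2 ∂μ ≤ ∫ ω, Y ω ^ 2 ∂μ ∧
      distLoss (∫ ω, X ω ^ 2 ∂μ) (∫ ω, (X ω - b * (Y ω - p)) ^ 2 ∂μ) (∫ ω, (Y ω - p) ^ 2 ∂μ) ≤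
        ∫ ω, (X ω - Y ω) ^ 2 ∂μ := by
  set p := ∫ ω, Y ω ∂μ with hp
  set Z : Ω → ℝ := fun ω ↦ Y ω - p with hZdef
  have hZ : MemLp Z 2 μ := hY.sub (memLp_const p)
  have hXX := hX.integrable_sq
  have hZZ := hZ.integrable_sq
  have hXZ : Integrable (fun ω ↦ X ω * Z ω) μ := hX.integrable_mul hZ
  have hX1 : Integrable X μ := hX.integrable (by norm_num)
  have hY1 : Integrable Y μ := hY.integrable (by norm_num)
  have hZ1 : Integrable Z μ := hZ.integrable (by norm_num)
  have hZ0 : ∫ ω, Z ω ∂μ = 0 := by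
    rw [hZdef, integral_sub hY1 (integrable_const p)]; simp [hp]
  set s2 := ∫ ω, X ω ^ 2 ∂μ
  set v := ∫ ω, Z ω ^ 2 ∂μ with hv
  set c := ∫ ω, X ω * Z ω ∂μ
  have hv0 : 0 ≤ v := integral_nonneg fun ω ↦ sq_nonneg _
  have key (t : ℝ) : ∫ ω, (X ω - t * Z ω) ^ 2 ∂μ = s2 - 2 * t * c + t ^ 2 * v := by
    have hi : Integrable (fun ω ↦ X ω ^ 2 - 2 * t * (X ω * Z ω)) μ := hXX.sub (hXZ.const_mul _)
    rw [← integral_const_mul, ← integral_const_mul, ← integral_sub hXX (hXZ.const_mul _),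
      ← integral_add hi (hZZ.const_mul _)]
    exact integral_congr_ae (ae_of_all _ fun ω ↦ by ring)
  have key0 (t : ℝ) : 0 ≤ s2 - 2 * t * c + t ^ 2 * v := by
    rw [← key t]; exact integral_nonneg fun ω ↦ sq_nonneg _
  have hYY : ∫ ω, Y ω ^ 2 ∂μ = v + p ^ 2 := by
    have : ∀ ω, Y ω ^ 2 = Z ω ^ 2 + 2 * p * Z ω + p ^ 2 := fun ω ↦ by simp only [hZdef]; ring
    have hi : Integrable (fun ω ↦ Z ω ^ 2 + 2 * p * Z ω) μ := hZZ.add (hZ1.const_mul _)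
    simp_rw [this]
    rw [integral_add hi (integrable_const _),
      integral_add hZZ (hZ1.const_mul _), integral_const_mul, hZ0]
    simp [hv]
  have hXY : ∫ ω, (X ω - Y ω) ^ 2 ∂μ = s2 - 2 * c + v + p ^ 2 := by
    have h1 : ∀ ω, (X ω - Y ω) ^ 2 =
        (X ω - 1 * Z ω) ^ 2 + (-(2 * p) * X ω + 2 * p * Z ω + p ^ 2) := fun ω ↦ by
      simp only [hZdef]; ring
    have hi : Integrable (fun ω ↦ (X ω - 1 * Z ω) ^ 2) μ := (hX.sub (hZ.const_mul 1)).integrable_sq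
    have hj : Integrable (fun ω ↦ -(2 * p) * X ω + 2 * p * Z ω) μ :=
      (hX1.const_mul _).add (hZ1.const_mul _)
    have hk : Integrable (fun ω ↦ -(2 * p) * X ω + 2 * p * Z ω + p ^ 2) μ :=
      hj.add (integrable_const _)
    simp_rw [h1]
    rw [integral_add hi hk, key, integral_add hj (integrable_const _),
      integral_add (hX1.const_mul _) (hZ1.const_mul _), integral_const_mul, integral_const_mul,
      hZ0, hX0]
    simp
  -- Regression coefficient. If v = 0, then c / v is 0 by convention, which is a correct slope
  -- because Y is almost surely constant.
  refine ⟨p, c / v, ?_, by rw [hYY]; nlinarith [sq_nonneg p], ?_⟩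
  · rw [key]
    rcases hv0.eq_or_lt with h | h
    · simp [← h]
    · have : s2 - 2 * (c / v) * c + (c / v) ^ 2 * v = s2 - c ^ 2 / v := by field_simp; ring
      rw [this]
      have : 0 ≤ c ^ 2 / v := by positivity
      linarith
  · rw [key, hXY, distLoss]
    rcases hv0.eq_or_lt with h | h
    · have hc : c = 0 := by
        by_contra hc
        -- For v = 0 the nonnegative quadratic in t is affine; at this t it would equal -1.
        have := key0 ((s2 + 1) / (2 * c))
        rw [← h] at this
        have h2 : 2 * ((s2 + 1) / (2 * c)) * c = s2 + 1 := by field_simp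
        linarith
      rw [← hv, ← h, hc]
      simp [sq_nonneg]
    -- The error is s2 - c² / v, so the square root in `distLoss` is |c| ≥ c.
    · have : v * (s2 - (s2 - 2 * (c / v) * c + (c / v) ^ 2 * v)) = c ^ 2 := by field_simp; ring
      rw [this, Real.sqrt_sq_eq_abs]
      nlinarith [le_abs_self c, sq_nonneg p]

section Converse

variable {ι : Type*} [Fintype ι]

/-- The test function is the log-likelihood ratio of independent normals with means m i y and
variances v i; its expectation involves only second moments. -/
lemma ofReal_sum_le_klDiv_prod {F : Type*} [MeasurableSpace F] {lam v : ι → ℝ≥0}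
    (hl : ∀ i, lam i ≠ 0) (hv : ∀ i, v i ≠ 0) {π : Measure ((ι → ℝ) × F)}
    [IsProbabilityMeasure π] {ν : Measure F} [IsProbabilityMeasure ν] {m : ι → F → ℝ}
    (hm : ∀ i, Measurable (m i)) (h1 : ∀ i, MemLp (fun p : (ι → ℝ) × F ↦ p.1 i) 2 π)
    (h2 : ∀ i, MemLp (fun p : (ι → ℝ) × F ↦ p.1 i - m i p.2) 2 π) :
    ENNReal.ofReal (∑ i, (1 / 2 * Real.log (lam i / v i) -
      (∫ p, (p.1 i - m i p.2) ^ 2 ∂π) / (2 * v i) + (∫ p, p.1 i ^ 2 ∂π) / (2 * lam i))) ≤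
    klDiv π ((Measure.pi fun i ↦ gaussianReal 0 (lam i)).prod ν) := by
  have hmeas : Measurable fun p : (ι → ℝ) × F ↦
      ∑ i, gaussLLR (lam i) (v i) (m i p.2) (p.1 i) := by
    unfold gaussLLR; fun_prop
  have hint (i : ι) : Integrable (fun p : (ι → ℝ) × F ↦
      gaussLLR (lam i) (v i) (m i p.2) (p.1 i)) π :=
    ((integrable_const _).sub ((h2 i).integrable_sq.div_const _)).add
      ((h1 i).integrable_sq.div_const _)
  refine le_trans (le_of_eq ?_) (ofReal_integral_le_klDiv hmeas
    (integrable_finsetSum _ fun i _ ↦ hint i) ?_)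
  · rw [integral_finsetSum _ fun i _ ↦ hint i]
    congr 1
    refine Finset.sum_congr rfl fun i _ ↦ ?_
    have hi : Integrable (fun p : (ι → ℝ) × F ↦ 1 / 2 * Real.log (lam i / v i) -
        (p.1 i - m i p.2) ^ 2 / (2 * v i)) π :=
      (integrable_const _).sub ((h2 i).integrable_sq.div_const _)
    unfold gaussLLR
    rw [integral_add hi ((h1 i).integrable_sq.div_const _), integral_sub (integrable_const _)
      ((h2 i).integrable_sq.div_const _), integral_div, integral_div]
    simp
  -- For fixed y the exponential is a probability density with respect to the Gaussian product, so
  -- the inner integral is 1.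
  · rw [lintegral_prod_symm _ (by unfold gaussLLR; fun_prop)]
    simp [lintegral_exp_sum_gaussLLR hl hv]

/-- The preceding bound with a one-point second factor. -/
lemma ofReal_sum_le_klDiv {lam v : ι → ℝ≥0}
    (hl : ∀ i, lam i ≠ 0) (hv : ∀ i, v i ≠ 0) {ν : Measure (ι → ℝ)}
    [IsProbabilityMeasure ν] (m : ι → ℝ) (h1 : ∀ i, MemLp (fun y : ι → ℝ ↦ y i) 2 ν) :
    ENNReal.ofReal (∑ i, (1 / 2 * Real.log (lam i / v i) -
      (∫ y, (y i - m i) ^ 2 ∂ν) / (2 * v i) + (∫ y, y i ^ 2 ∂ν) / (2 * lam i))) ≤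
    klDiv ν (Measure.pi fun i ↦ gaussianReal 0 (lam i)) := by
  have hg : Measurable fun y : ι → ℝ ↦ (y, ()) := by fun_prop
  have hprob := Measure.isProbabilityMeasure_map (μ := ν) hg.aemeasurable
  have h1' (i : ι) :
      MemLp (fun p : (ι → ℝ) × Unit ↦ p.1 i) 2 (ν.map fun y : ι → ℝ ↦ (y, ())) :=
    (memLp_map_measure_iff (by fun_prop) hg.aemeasurable).2 (h1 i)
  have h := (ofReal_sum_le_klDiv_prod hl hv (π := ν.map fun y ↦ (y, ())) (ν := Measure.dirac ())
    (m := fun i _ ↦ m i) (fun i ↦ measurable_const) h1'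
    fun i ↦ (h1' i).sub (memLp_const _))
  rw [Measure.prod_dirac] at h
  refine le_of_eq_of_le ?_ (h.trans (klDiv_map_le _ _ hg))
  congr! with i _ i _
  · rw [integral_map hg.aemeasurable (by fun_prop)]
  · rw [integral_map hg.aemeasurable (by fun_prop)]

/-- Optimization over v: the best choice is v = s, and s i = 0 is excluded because v i → 0 would
make the bound unbounded. -/
lemma pos_and_sum_le_of_forall {lam : ι → ℝ≥0} (hl : ∀ i, lam i ≠ 0) {s t : ι → ℝ}
    (hs : ∀ i, 0 ≤ s i) {I : ℝ≥0∞} (hI : I ≠ ⊤)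
    (h : ∀ v : ι → ℝ≥0, (∀ i, v i ≠ 0) → ENNReal.ofReal (∑ i, (1 / 2 * Real.log (lam i / v i) -
      s i / (2 * v i) + t i / (2 * lam i))) ≤ I) :
    (∀ i, 0 < s i) ∧
      ∑ i, 1 / 2 * (t i / lam i - 1 + Real.log (lam i / s i)) ≤ I.toReal := by
  have hl' (i : ι) : (0 : ℝ) < lam i := by have := hl i; positivity
  have h' (v : ι → ℝ) (hv : ∀ i, 0 < v i) : ∑ i, (1 / 2 * Real.log (lam i / v i) -
      s i / (2 * v i) + t i / (2 * lam i)) ≤ I.toReal := by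
    have := h (fun i ↦ (v i).toNNReal) fun i ↦ by simpa using hv i
    simp only [Real.coe_toNNReal _ (hv _).le] at this
    rwa [ENNReal.ofReal_le_iff_le_toReal hI] at this
  have hpos (i : ι) : 0 < s i := by
    classical
    by_contra hk
    have hk : s i = 0 := le_antisymm (not_lt.1 hk) (hs i)
    -- With v j = lam j for j ≠ i, C is the part of the sum that does not depend on v i. The choice
    -- e of v i makes the logarithmic term I + |C| + 1, so the sum exceeds I.
    set C := t i / (2 * lam i) + ∑ j ∈ Finset.univ.erase i,
      (- s j / (2 * lam j) + t j / (2 * lam j)) with hC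
    set e := lam i * Real.exp (-(2 * (I.toReal + |C| + 1))) with he
    have he0 : 0 < e := by have := hl' i; positivity
    have h1 := h' (Function.update (fun j ↦ (lam j : ℝ)) i e) fun j ↦ by
      by_cases hj : j = i
      · subst hj; simpa using he0
      · simpa [hj] using hl' j
    rw [← Finset.add_sum_erase _ _ (Finset.mem_univ i)] at h1
    have h2 : ∑ j ∈ Finset.univ.erase i, (1 / 2 * Real.log (lam j /
        Function.update (fun j ↦ (lam j : ℝ)) i e j) -
        s j / (2 * Function.update (fun j ↦ (lam j : ℝ)) i e j) + t j / (2 * lam j)) =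
        ∑ j ∈ Finset.univ.erase i, (- s j / (2 * lam j) + t j / (2 * lam j)) := by
      refine Finset.sum_congr rfl fun j hj ↦ ?_
      rw [Function.update_of_ne (Finset.ne_of_mem_erase hj), div_self (hl' j).ne']
      simp; ring
    have h3 : Real.log (lam i / e) = 2 * (I.toReal + |C| + 1) := by
      rw [he, div_mul_cancel_left₀ (hl' i).ne', ← Real.exp_neg, Real.log_exp]; ring
    rw [h2, Function.update_self, h3, hk] at h1
    have := neg_abs_le C
    simp only [zero_div, sub_zero] at h1
    linarith
  refine ⟨hpos, le_of_eq_of_le (Finset.sum_congr rfl fun i _ ↦ ?_) (h' s hpos)⟩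
  have := hl' i
  have := hpos i
  field_simp
  ring

end Converse

/-- The single-letter lower bound, in the eigenbasis of the covariance of the source. -/
lemma exists_feasible_of_coupling {L : ℕ} {lam : Fin L → ℝ≥0} (hl : ∀ l, lam l ≠ 0)
    {D : ℝ≥0} {P : ℝ≥0∞} {π : Measure ((Fin L → ℝ) × (Fin L → ℝ))} [IsProbabilityMeasure π]
    (hfst : π.fst = Measure.pi fun l ↦ gaussianReal 0 (lam l))
    (hD : ∫⁻ p, ∑ l, ‖p.1 l - p.2 l‖ₑ ^ 2 ∂π ≤ D)
    (hP : klDiv π.snd (Measure.pi fun l ↦ gaussianReal 0 (lam l)) ≤ P)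
    (hI : mutualInfo π ≠ ⊤) :
    ∃ q ∈ feasible (fun l ↦ (lam l : ℝ)) D P,
      rate (fun l ↦ (lam l : ℝ)) q ≤ (mutualInfo π).toReal := by
  have hlaw (l : Fin L) :
      MeasurePreserving (fun p : (Fin L → ℝ) × (Fin L → ℝ) ↦ p.1 l) π (gaussianReal 0 (lam l)) :=
    (measurePreserving_eval (fun l ↦ gaussianReal 0 (lam l)) l).comp ⟨measurable_fst, hfst⟩
  have hX (l : Fin L) : MemLp (fun p : (Fin L → ℝ) × (Fin L → ℝ) ↦ p.1 l) 2 π :=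
    (memLp_id_gaussianReal' 2 (by norm_num)).comp_measurePreserving (hlaw l)
  have hX0 (l : Fin L) : ∫ p, p.1 l ∂π = 0 := by
    have := integral_map (μ := π) (f := fun x : ℝ ↦ x) (hlaw l).measurable.aemeasurable
      (by fun_prop)
    rw [← this, (hlaw l).map_eq, integral_id_gaussianReal]
  have hX2 (l : Fin L) : ∫ p, p.1 l ^ 2 ∂π = lam l := by
    have := integral_map (μ := π) (f := fun x : ℝ ↦ x ^ 2) (hlaw l).measurable.aemeasurable
      (by fun_prop)
    rw [← this, (hlaw l).map_eq, integral_sq_gaussianReal]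
  rw [lintegral_finsetSum _ fun l _ ↦ by fun_prop] at hD
  have hXY (l : Fin L) : MemLp (fun p : (Fin L → ℝ) × (Fin L → ℝ) ↦ p.1 l - p.2 l) 2 π := by
    refine ⟨by fun_prop, ?_⟩
    rw [eLpNorm_lt_top_iff_lintegral_rpow_enorm_lt_top (by norm_num) (by norm_num)]
    have := (Finset.single_le_sum (fun l _ ↦ zero_le) (Finset.mem_univ l)).trans hD
    simpa using this.trans_lt ENNReal.coe_lt_top
  have hY (l : Fin L) : MemLp (fun p : (Fin L → ℝ) × (Fin L → ℝ) ↦ p.2 l) 2 π := by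
    convert (hX l).sub (hXY l) using 1
    ext q
    simp
  choose p b hb1 hb2 hb3 using fun l ↦ exists_affine_estimate (hX l) (hY l) (hX0 l)
  simp only [hX2] at hb1 hb3
  have hsq : ∀ l, ∫⁻ p, ‖p.1 l - p.2 l‖ₑ ^ 2 ∂π = ENNReal.ofReal (∫ p, (p.1 l - p.2 l) ^ 2 ∂π) :=
    fun l ↦ by
      rw [ofReal_integral_eq_lintegral_ofReal (hXY l).integrable_sq
        (ae_of_all _ fun _ ↦ sq_nonneg _)]
      exact lintegral_congr fun q ↦ enorm_sq_eq_ofReal_sq _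
  have hD' : ∑ l, ∫ p, (p.1 l - p.2 l) ^ 2 ∂π ≤ (D : ℝ) := by
    simp_rw [hsq] at hD
    rw [← ENNReal.ofReal_sum_of_nonneg fun l _ ↦ integral_nonneg fun _ ↦ sq_nonneg _] at hD
    exact (ENNReal.ofReal_le_iff_le_toReal ENNReal.coe_ne_top).1 hD
  -- The mean of the test density at y is the affine estimate of the source component.
  have hmi (v : Fin L → ℝ≥0) (hv : ∀ i, v i ≠ 0) := ofReal_sum_le_klDiv_prod hl hv (π := π)
    (ν := π.snd) (m := fun l y ↦ b l * (y l - p l)) (fun l ↦ by fun_prop) hX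
    fun l ↦ (hX l).sub (((hY l).sub (memLp_const _)).const_mul _)
  rw [← hfst] at hmi
  obtain ⟨hpos, hsum⟩ := pos_and_sum_le_of_forall hl
    (fun l ↦ integral_nonneg fun _ ↦ sq_nonneg _) hI hmi
  refine ⟨(fun l ↦ ∫ q, (q.1 l - b l * (q.2 l - p l)) ^ 2 ∂π, fun l ↦ ∫ q, (q.2 l - p l) ^ 2 ∂π),
    ⟨fun l ↦ ⟨hpos l, hb1 l⟩, fun l ↦ integral_nonneg fun _ ↦ sq_nonneg _,
      (Finset.sum_le_sum fun l _ ↦ hb3 l).trans hD', ?_⟩, ?_⟩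
  · by_cases hPtop : P = ⊤
    · simp [hPtop]
    have hYsnd (l : Fin L) : MemLp (fun y : Fin L → ℝ ↦ y l) 2 π.snd :=
      (memLp_map_measure_iff (measurable_pi_apply l).aestronglyMeasurable measurable_snd.aemeasurable).2 (hY l)
    have hpe (v : Fin L → ℝ≥0) (hv : ∀ i, v i ≠ 0) :=
      (ofReal_sum_le_klDiv hl hv p hYsnd).trans hP
    obtain ⟨hpos', hsum'⟩ := pos_and_sum_le_of_forall hl
      (fun l ↦ integral_nonneg fun _ ↦ sq_nonneg _) hPtop hpe
    have e1 (l : Fin L) : ∫ y, (y l - p l) ^ 2 ∂π.snd = ∫ q, (q.2 l - p l) ^ 2 ∂π :=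
      integral_map measurable_snd.aemeasurable
        (((measurable_pi_apply l).sub_const _).pow_const 2).aestronglyMeasurable
    have e2 (l : Fin L) : ∫ y, y l ^ 2 ∂π.snd = ∫ q, q.2 l ^ 2 ∂π :=
      integral_map measurable_snd.aemeasurable
        ((measurable_pi_apply l).pow_const 2).aestronglyMeasurable
    simp only [e1, e2] at hpos' hsum'
    refine (sum_percLoss_le_iff (fun l ↦ by have := hl l; positivity)
      (fun l ↦ (hpos' l).le) hPtop).2 ⟨hpos', ?_⟩
    -- `hsum'` contains the raw second moment of Y l, which is at least its variance λ̂ l.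
    refine le_trans (Finset.sum_le_sum fun l _ ↦ ?_) hsum'
    have := div_le_div_of_nonneg_right (hb2 l) (lam l).coe_nonneg
    linarith
  · simp only [hX2] at hsum
    refine le_of_eq_of_le ?_ hsum
    rw [rate, Finset.mul_sum]
    refine Finset.sum_congr rfl fun l _ ↦ ?_
    rw [div_self (by exact_mod_cast hl l), sub_self, zero_add]

/-! ### Achievability: Gaussian backward channels -/

lemma integrable_sq_gaussianReal (v : ℝ≥0) : Integrable (fun x ↦ x ^ 2) (gaussianReal 0 v) :=
  (memLp_id_gaussianReal' (μ := 0) (v := v) 2 (by norm_num)).integrable_sq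

/-- The joint law of `(b * Y + N, Y)`, for independent `Y ∼ N(0, lamHat)` and `N ∼ N(0, gam)`. -/
noncomputable def scalarCoupling (b : ℝ) (lamHat gam : ℝ≥0) : Measure (ℝ × ℝ) :=
  ((gaussianReal 0 lamHat).prod (gaussianReal 0 gam)).map fun q ↦ (b * q.1 + q.2, q.1)

section scalarCoupling

variable {b : ℝ} {lamHat gam lam : ℝ≥0}

instance : IsProbabilityMeasure (scalarCoupling b lamHat gam) :=
  Measure.isProbabilityMeasure_map (by fun_prop)

lemma scalarCoupling_snd : (scalarCoupling b lamHat gam).snd = gaussianReal 0 lamHat := by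
  rw [scalarCoupling, Measure.snd_map_prodMk (by fun_prop)]
  exact measurePreserving_fst.map_eq

lemma scalarCoupling_fst (h : b ^ 2 * lamHat + gam = lam) :
    (scalarCoupling b lamHat gam).fst = gaussianReal 0 lam := by
  rw [scalarCoupling, Measure.fst_map_prodMk (by fun_prop)]
  have h1 : (gaussianReal 0 lamHat).map (b * ·) =
      gaussianReal 0 (.mk (b ^ 2) (sq_nonneg _) * lamHat) := by
    rw [gaussianReal_map_const_mul, mul_zero]
  have h2 : lam = .mk (b ^ 2) (sq_nonneg _) * lamHat + gam := by
    ext; simpa using h.symm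
  have h3 := gaussianReal_conv_gaussianReal (m₁ := 0) (m₂ := 0)
    (v₁ := .mk (b ^ 2) (sq_nonneg _) * lamHat) (v₂ := gam)
  rw [add_zero, ← h2, ← h1, Measure.conv] at h3
  rw [← Measure.map_id (μ := gaussianReal 0 gam), Measure.map_prod_map _ _ (by fun_prop) (by fun_prop),
    Measure.map_map (by fun_prop) (by fun_prop)] at h3
  exact h3

/-- Given Y = y, the first coordinate is N(b y, gam). Only this conditional law needs a density, so
a degenerate Y (`lamHat = 0`) is allowed. -/
lemma scalarCoupling_eq_withDensity (hg : gam ≠ 0) (hl : lam ≠ 0) :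
    scalarCoupling b lamHat gam = ((gaussianReal 0 lam).prod (gaussianReal 0 lamHat)).withDensity
      fun q ↦ ENNReal.ofReal (Real.exp (gaussLLR lam gam (b * q.2) q.1)) := by
  ext s hs
  have hT : Measurable fun q : ℝ × ℝ ↦ (b * q.1 + q.2, q.1) := by fun_prop
  have hsT : Measurable fun q : ℝ × ℝ ↦ s.indicator (1 : ℝ × ℝ → ℝ≥0∞) (b * q.1 + q.2, q.1) :=
    (measurable_one.indicator hs).comp hT
  have hm : Measurable fun q : ℝ × ℝ ↦
      ENNReal.ofReal (Real.exp (gaussLLR lam gam (b * q.2) q.1)) := by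
    unfold gaussLLR; fun_prop
  rw [withDensity_apply _ hs, ← lintegral_indicator hs, lintegral_prod_symm _
    (hm.indicator hs).aemeasurable, ← lintegral_indicator_one hs, scalarCoupling,
    lintegral_map (measurable_one.indicator hs) hT, lintegral_prod _
    hsT.aemeasurable]
  refine lintegral_congr fun y ↦ ?_
  have h1 := gaussianReal_map_const_add (μ := 0) (v := gam) (b * y)
  rw [zero_add, gaussianReal_eq_withDensity hl hg (b * y)] at h1
  have hs' : Measurable fun x : ℝ ↦ s.indicator (1 : ℝ × ℝ → ℝ≥0∞) (x, y) :=
    (measurable_one.indicator hs).comp (by fun_prop)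
  have h2 := lintegral_map (μ := gaussianReal 0 gam) hs' (show Measurable (b * y + ·) by fun_prop)
  rw [← h2, h1, lintegral_withDensity_eq_lintegral_mul _ (by unfold gaussLLR; fun_prop) hs']
  refine lintegral_congr fun x ↦ ?_
  by_cases hx : (x, y) ∈ s <;> simp [hx]

/-- The two quadratic terms have expectations -1/2 and 1/2 and cancel. -/
lemma integral_gaussLLR_scalarCoupling (h : b ^ 2 * lamHat + gam = lam) (hg : gam ≠ 0)
    (hl : lam ≠ 0) :
    Integrable (fun q : ℝ × ℝ ↦ gaussLLR lam gam (b * q.2) q.1) (scalarCoupling b lamHat gam) ∧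
    ∫ q, gaussLLR lam gam (b * q.2) q.1 ∂(scalarCoupling b lamHat gam) =
      1 / 2 * Real.log (lam / gam) := by
  have hT : Measurable fun q : ℝ × ℝ ↦ (b * q.1 + q.2, q.1) := by fun_prop
  have hN : MeasurePreserving (fun q : ℝ × ℝ ↦ q.1 - b * q.2) (scalarCoupling b lamHat gam)
      (gaussianReal 0 gam) := by
    refine ⟨by fun_prop, ?_⟩
    rw [scalarCoupling, Measure.map_map (by fun_prop) hT]
    convert (measurePreserving_snd (μ := gaussianReal 0 lamHat) (ν := gaussianReal 0 gam)).map_eq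
      using 2
    ext q
    simp
  have hX : MeasurePreserving Prod.fst (scalarCoupling b lamHat gam) (gaussianReal 0 lam) :=
    ⟨measurable_fst, scalarCoupling_fst h⟩
  have iN : Integrable (fun q : ℝ × ℝ ↦ (q.1 - b * q.2) ^ 2 / (2 * gam))
      (scalarCoupling b lamHat gam) :=
    (hN.integrable_comp_of_integrable (integrable_sq_gaussianReal gam)).div_const _
  have iX : Integrable (fun q : ℝ × ℝ ↦ q.1 ^ 2 / (2 * lam)) (scalarCoupling b lamHat gam) :=
    (hX.integrable_comp_of_integrable (integrable_sq_gaussianReal lam)).div_const _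
  have eN : ∫ q, (q.1 - b * q.2) ^ 2 ∂(scalarCoupling b lamHat gam) = gam := by
    have := integral_map hN.measurable.aemeasurable (μ := scalarCoupling b lamHat gam)
      (f := fun x : ℝ ↦ x ^ 2) (by fun_prop)
    rw [← this, hN.map_eq, integral_sq_gaussianReal]
  have eX : ∫ q, q.1 ^ 2 ∂(scalarCoupling b lamHat gam) = lam := by
    have := integral_map hX.measurable.aemeasurable (μ := scalarCoupling b lamHat gam)
      (f := fun x : ℝ ↦ x ^ 2) (by fun_prop)
    rw [← this, hX.map_eq, integral_sq_gaussianReal]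
  have i1 : Integrable (fun q : ℝ × ℝ ↦ 1 / 2 * Real.log (lam / gam) -
      (q.1 - b * q.2) ^ 2 / (2 * gam)) (scalarCoupling b lamHat gam) :=
    (integrable_const _).sub iN
  refine ⟨i1.add iX, ?_⟩
  unfold gaussLLR
  rw [integral_add i1 iX, integral_sub (integrable_const _) iN, integral_div, integral_div, eN, eX]
  have : (gam : ℝ) ≠ 0 := by exact_mod_cast hg
  have : (lam : ℝ) ≠ 0 := by exact_mod_cast hl
  simp
  field_simp
  ring

lemma lintegral_sq_sub_scalarCoupling :
    ∫⁻ q, ‖q.1 - q.2‖ₑ ^ 2 ∂(scalarCoupling b lamHat gam) =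
      ENNReal.ofReal ((b - 1) ^ 2 * lamHat + gam) := by
  have h1 : MeasurePreserving (fun q : ℝ × ℝ ↦ q.1 - q.2) (scalarCoupling b lamHat gam)
      (gaussianReal 0 (.mk ((b - 1) ^ 2) (sq_nonneg _) * lamHat + gam)) := by
    refine ⟨by fun_prop, ?_⟩
    -- The difference (b - 1) Y + N is the first coordinate of the coupling with slope b - 1.
    rw [← scalarCoupling_fst (b := b - 1) (lamHat := lamHat) (gam := gam) (by simp),
      scalarCoupling, scalarCoupling, Measure.fst_map_prodMk (by fun_prop),
      Measure.map_map (by fun_prop) (by fun_prop)]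
    congr 1
    ext q
    simp only [Function.comp_apply]
    ring
  have h2 := h1.lintegral_comp (f := fun x : ℝ ↦ ‖x‖ₑ ^ 2) (by fun_prop)
  rw [h2]
  simp_rw [enorm_sq_eq_ofReal_sq]
  rw [← ofReal_integral_eq_lintegral_ofReal (integrable_sq_gaussianReal _)
    (ae_of_all _ fun _ ↦ sq_nonneg _), integral_sq_gaussianReal]
  simp

end scalarCoupling

/-- A Gaussian coupling attaining the distortion and the rate of one component. -/
lemma exists_scalar_coupling {lam gam lamHat : ℝ≥0} (hg : gam ≠ 0) (hgl : gam ≤ lam) :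
    ∃ (π : Measure (ℝ × ℝ)) (f : ℝ × ℝ → ℝ), IsProbabilityMeasure π ∧
      π.fst = gaussianReal 0 lam ∧ π.snd = gaussianReal 0 lamHat ∧ Measurable f ∧
      Integrable f π ∧ π = ((gaussianReal 0 lam).prod (gaussianReal 0 lamHat)).withDensity
        (fun q ↦ ENNReal.ofReal (Real.exp (f q))) ∧
      ∫ q, f q ∂π ≤ 1 / 2 * Real.log (lam / gam) ∧
      ∫⁻ q, ‖q.1 - q.2‖ₑ ^ 2 ∂π = ENNReal.ofReal (distLoss lam gam lamHat) := by
  have hl : lam ≠ 0 := fun h ↦ hg (le_antisymm (h ▸ hgl) zero_le)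
  have hl0 : (0 : ℝ) < lam := by positivity
  have hg0 : (0 : ℝ) < gam := by positivity
  have hgl' : (gam : ℝ) ≤ lam := by exact_mod_cast hgl
  -- A noise variance above `gam` only lowers the rate. This is needed when `lamHat = 0`: then Y = 0
  -- and the noise must carry the whole variance `lam`.
  suffices main : ∃ (b : ℝ) (gam' : ℝ≥0), gam' ≠ 0 ∧ gam ≤ gam' ∧ b ^ 2 * lamHat + gam' = lam ∧
      (b - 1) ^ 2 * lamHat + gam' = distLoss lam gam lamHat by
    obtain ⟨b, gam', hg', hgg, h, hd⟩ := main
    obtain ⟨h1, h2⟩ := integral_gaussLLR_scalarCoupling h hg' hl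
    refine ⟨scalarCoupling b lamHat gam', fun q ↦ gaussLLR lam gam' (b * q.2) q.1, inferInstance,
      scalarCoupling_fst h, scalarCoupling_snd, by unfold gaussLLR; fun_prop, h1,
      scalarCoupling_eq_withDensity hg' hl, ?_, by rw [lintegral_sq_sub_scalarCoupling, hd]⟩
    rw [h2]
    have : (0 : ℝ) < gam' := by positivity
    gcongr
  by_cases h0 : lamHat = 0
  · exact ⟨0, lam, hl, hgl, by simp, by simp [h0, distLoss]⟩
  · have hh0 : (0 : ℝ) < lamHat := by positivity
    have hb : √((lam - gam) / lamHat) ^ 2 * lamHat = lam - gam := by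
      rw [Real.sq_sqrt (div_nonneg (sub_nonneg.2 hgl') hh0.le)]
      field_simp
    have hb' : √(lamHat * (lam - gam)) = √((lam - gam) / lamHat) * lamHat := by
      rw [Real.sqrt_eq_iff_mul_self_eq (by nlinarith) (by positivity)]
      linear_combination -lamHat * hb
    refine ⟨√((lam - gam) / lamHat), gam, hg, le_rfl, by rw [hb]; ring, ?_⟩
    rw [distLoss, hb']
    linear_combination hb

/-- Coercivity in λ̂, by the arithmetic-geometric mean inequality; it bounds λ̂ on the feasible set.
-/
lemma distLoss_ge {lam gam lamHat : ℝ} (hg : 0 < gam) (hgl : gam ≤ lam) (hh : 0 ≤ lamHat) :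
    lamHat / 2 - lam ≤ distLoss lam gam lamHat := by
  have : √(lamHat * (lam - gam)) ≤ lam + lamHat / 4 := by
    apply Real.sqrt_le_iff.2 ⟨by linarith, ?_⟩
    nlinarith [sq_nonneg (lam - lamHat / 4), mul_nonneg hh hg.le]
  rw [distLoss]
  linarith

lemma distLoss_nonneg {lam gam lamHat : ℝ} (hg : 0 < gam) (hgl : gam ≤ lam) (hh : 0 ≤ lamHat) :
    0 ≤ distLoss lam gam lamHat := by
  have : √(lamHat * (lam - gam)) ≤ (lam + lamHat) / 2 := by
    apply Real.sqrt_le_iff.2 ⟨by linarith, ?_⟩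
    nlinarith [sq_nonneg (lam - lamHat), mul_nonneg hh hg.le]
  rw [distLoss]
  linarith

/-- A Gaussian coupling for each feasible point, in the eigenbasis of the covariance. -/
lemma exists_coupling_of_feasible {L : ℕ} {lam : Fin L → ℝ≥0} (hl : ∀ l, lam l ≠ 0)
    {D : ℝ≥0} {P : ℝ≥0∞} {q : (Fin L → ℝ) × (Fin L → ℝ)}
    (hq : q ∈ feasible (fun l ↦ (lam l : ℝ)) D P) :
    ∃ π : Measure ((Fin L → ℝ) × (Fin L → ℝ)), IsProbabilityMeasure π ∧
      π.fst = Measure.pi (fun l ↦ gaussianReal 0 (lam l)) ∧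
      ∫⁻ p, ∑ l, ‖p.1 l - p.2 l‖ₑ ^ 2 ∂π ≤ D ∧
      klDiv π.snd (Measure.pi fun l ↦ gaussianReal 0 (lam l)) ≤ P ∧
      mutualInfo π ≤ ENNReal.ofReal (rate (fun l ↦ (lam l : ℝ)) q) := by
  obtain ⟨gam, lamHat⟩ := q
  obtain ⟨hgam, hhat, hD, hP⟩ := hq
  simp only at hgam hhat hD hP
  lift gam to Fin L → ℝ≥0 using fun l ↦ (hgam l).1.le
  lift lamHat to Fin L → ℝ≥0 using hhat
  choose π f hprob hfst hsnd hf hfint hdens hint hdist using fun l ↦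
    exists_scalar_coupling (lam := lam l) (gam := gam l) (lamHat := lamHat l)
      (by have := (hgam l).1; simp at this; exact this.ne') (by exact_mod_cast (hgam l).2)
  have hmp (l : Fin L) := measurePreserving_eval π l
  set e := MeasurableEquiv.arrowProdEquivProdArrow ℝ ℝ (Fin L)
  have he : Measurable e := e.measurable
  have hPi : IsProbabilityMeasure ((Measure.pi π).map e) :=
    Measure.isProbabilityMeasure_map he.aemeasurable
  have h1 : ((Measure.pi π).map e).fst = Measure.pi (fun l ↦ gaussianReal 0 (lam l)) := by
    have (l : Fin L) : IsProbabilityMeasure ((π l).map Prod.fst) :=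
      Measure.isProbabilityMeasure_map (by fun_prop)
    rw [Measure.fst, Measure.map_map measurable_fst he]
    simp_rw [← hfst, Measure.fst]
    exact Measure.pi_map_pi (f := fun _ ↦ Prod.fst) fun l ↦ by fun_prop
  have h2 : ((Measure.pi π).map e).snd = Measure.pi (fun l ↦ gaussianReal 0 (lamHat l)) := by
    have (l : Fin L) : IsProbabilityMeasure ((π l).map Prod.snd) :=
      Measure.isProbabilityMeasure_map (by fun_prop)
    rw [Measure.snd, Measure.map_map measurable_snd he]
    simp_rw [← hsnd, Measure.snd]
    exact Measure.pi_map_pi (f := fun _ ↦ Prod.snd) fun l ↦ by fun_prop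
  refine ⟨(Measure.pi π).map e, hPi, h1, ?_, ?_, ?_⟩
  · rw [lintegral_map (by fun_prop) he, lintegral_finsetSum]
    · have (l : Fin L) : ∫⁻ p, ‖(e p).1 l - (e p).2 l‖ₑ ^ 2 ∂Measure.pi π =
          ENNReal.ofReal (distLoss (lam l) (gam l) (lamHat l)) := by
        rw [← hdist l, ← (hmp l).lintegral_comp (f := fun q : ℝ × ℝ ↦ ‖q.1 - q.2‖ₑ ^ 2)
          (by fun_prop)]
        rfl
      simp_rw [this]
      rw [← ENNReal.ofReal_sum_of_nonneg]
      · rw [← ENNReal.ofReal_coe_nnreal]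
        exact ENNReal.ofReal_le_ofReal hD
      · exact fun l _ ↦ distLoss_nonneg (hgam l).1 (hgam l).2 (lamHat l).coe_nonneg
    · intro l _
      exact ((((measurable_pi_apply l).comp measurable_fst).sub
        ((measurable_pi_apply l).comp measurable_snd)).enorm.pow_const 2).comp he
  · by_cases hPtop : P = ⊤
    · simp [hPtop]
    obtain ⟨hpos, hsum⟩ := (sum_percLoss_le_iff (fun l ↦ (hgam l).1.trans_le (hgam l).2)
      (fun l ↦ (lamHat l).coe_nonneg) hPtop).1 hP
    have hne (l : Fin L) : lamHat l ≠ 0 := fun h0 ↦ (hpos l).ne' (by simp [h0])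
    have hint' (l : Fin L) : Integrable (fun x ↦ 1 / 2 * Real.log (lam l / lamHat l) -
        (x - 0) ^ 2 / (2 * lamHat l)) (gaussianReal 0 (lamHat l)) := by
      simp only [sub_zero]
      exact (integrable_const _).sub ((integrable_sq_gaussianReal _).div_const _)
    rw [h2, klDiv_pi_withDensity_exp (f := fun l ↦ gaussLLR (lam l) (lamHat l) 0) _ _
      (fun l ↦ by unfold gaussLLR; fun_prop)
      (fun l ↦ (hint' l).add ((integrable_sq_gaussianReal _).div_const _))
      fun l ↦ gaussianReal_eq_withDensity (hl l) (hne l) 0]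
    have hval (l : Fin L) : ∫ x, gaussLLR (lam l) (lamHat l) 0 x ∂(gaussianReal 0 (lamHat l)) =
        1 / 2 * (lamHat l / lam l - 1 + Real.log (lam l / lamHat l)) := by
      unfold gaussLLR
      rw [integral_add (hint' l) ((integrable_sq_gaussianReal _).div_const _)]
      simp only [sub_zero]
      rw [integral_sub (integrable_const _) ((integrable_sq_gaussianReal _).div_const _),
        integral_div, integral_div, integral_sq_gaussianReal]
      have : (lamHat l : ℝ) ≠ 0 := by exact_mod_cast hne l
      have : (lam l : ℝ) ≠ 0 := by exact_mod_cast hl l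
      simp
      field_simp
      ring
    simp_rw [hval]
    exact ENNReal.ofReal_le_of_le_toReal hsum
  · have h3 := (measurePreserving_arrowProdEquivProdArrow ℝ ℝ (Fin L)
      (fun l ↦ gaussianReal 0 (lam l)) fun l ↦ gaussianReal 0 (lamHat l)).map_eq
    rw [mutualInfo, h1, h2, ← h3]
    -- Regrouping the coordinates does not increase the divergence, which is additive over the
    -- independent pairs.
    refine (klDiv_map_le _ _ he).trans ?_
    rw [klDiv_pi_withDensity_exp _ _ hf hfint hdens, rate, Finset.mul_sum]
    exact ENNReal.ofReal_le_ofReal (Finset.sum_le_sum fun l _ ↦ hint l)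

/-! ### Feasibility and attainment of the minimum -/

section Minimum

variable {L : ℕ} {lam : Fin L → ℝ} {D : ℝ≥0} {P : ℝ≥0∞}

lemma feasible_nonempty (hl : ∀ l, 0 < lam l) (hD : 0 < D) : (feasible lam D P).Nonempty := by
  have hD' : (0 : ℝ) < D := hD
  have hs : 0 ≤ ∑ l, lam l := Finset.sum_nonneg fun l _ ↦ (hl l).le
  -- With λ̂ = λ the perception loss is 0, and γ = t λ costs at most 2 t λ in distortion. The added
  -- 1 keeps the denominator positive when L = 0.
  set t : ℝ := min 1 (D / (2 * ∑ l, lam l + 1)) with ht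
  have ht0 : 0 < t := by positivity
  have ht1 : t ≤ 1 := min_le_left _ _
  have ht2 : t * (2 * ∑ l, lam l + 1) ≤ D := by
    rw [← le_div_iff₀ (by positivity)]; exact min_le_right _ _
  refine ⟨(fun l ↦ t * lam l, lam), fun l ↦ ⟨mul_pos ht0 (hl l), ?_⟩, fun l ↦ (hl l).le, ?_, ?_⟩
  · exact mul_le_of_le_one_left (hl l).le ht1
  · have h (l : Fin L) : distLoss (lam l) (t * lam l) (lam l) ≤ 2 * t * lam l := by
      have : lam l * (1 - t) ≤ √(lam l * (lam l - t * lam l)) := by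
        apply Real.le_sqrt_of_sq_le
        have := hl l
        nlinarith [mul_nonneg (mul_nonneg (sq_nonneg (lam l)) ht0.le) (sub_nonneg.2 ht1)]
      rw [distLoss]
      linarith
    refine (Finset.sum_le_sum fun l _ ↦ h l).trans ?_
    rw [← Finset.mul_sum]
    linarith
  · simp [percLoss, (hl _).ne', EReal.coe_ennreal_nonneg]

lemma log_div_nonneg {a b : ℝ} (h : 0 < b ∧ b ≤ a) : 0 ≤ Real.log (a / b) :=
  Real.log_nonneg ((one_le_div h.1).2 h.2)

lemma rate_nonneg {q : (Fin L → ℝ) × (Fin L → ℝ)} (hq : q ∈ feasible lam D P) :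
    0 ≤ rate lam q :=
  mul_nonneg (by norm_num) (Finset.sum_nonneg fun l _ ↦ log_div_nonneg (hq.1 l))

lemma mul_exp_neg_le_of_log_div_le {a b c : ℝ} (ha : 0 < a) (hb : 0 < b)
    (h : Real.log (a / b) ≤ c) : a * Real.exp (-c) ≤ b := by
  rw [Real.log_le_iff_le_exp (by positivity), div_le_iff₀ hb] at h
  rw [Real.exp_neg, ← div_eq_mul_inv, div_le_iff₀ (Real.exp_pos _)]
  linarith

/-- A lower bound for the variances of the reconstruction. -/
noncomputable def lamHatLower (lam : Fin L → ℝ) (P : ℝ≥0∞) (l : Fin L) : ℝ :=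
  if P = ⊤ then 0 else lam l * Real.exp (-(2 * P.toReal + 1))

/-- A box that contains the feasible points of rate at most `c`. -/
def paramBox (lam : Fin L → ℝ) (D : ℝ≥0) (P : ℝ≥0∞) (c : ℝ) : Set ((Fin L → ℝ) × (Fin L → ℝ)) :=
  Set.Icc (fun l ↦ lam l * Real.exp (-(2 * c)), lamHatLower lam P)
    (lam, fun l ↦ 2 * (D + lam l))

lemma mem_paramBox (hl : ∀ l, 0 < lam l) {c : ℝ} {q : (Fin L → ℝ) × (Fin L → ℝ)}
    (hq : q ∈ feasible lam D P) (hc : rate lam q ≤ c) : q ∈ paramBox lam D P c := by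
  obtain ⟨hgam, hhat, hD, hP⟩ := hq
  refine ⟨⟨fun l ↦ ?_, fun l ↦ ?_⟩, fun l ↦ (hgam l).2, fun l ↦ ?_⟩
  · apply mul_exp_neg_le_of_log_div_le (hl l) (hgam l).1
    have := Finset.single_le_sum (fun l _ ↦ log_div_nonneg (hgam l)) (Finset.mem_univ l)
    rw [rate] at hc
    linarith
  · simp only [lamHatLower]
    split_ifs with hPtop
    · exact hhat l
    obtain ⟨hpos, -⟩ := (sum_percLoss_le_iff hl hhat hPtop).1 hP
    have h := (Finset.single_le_sum (fun l _ ↦ percLoss_nonneg (hl l) (hhat l))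
      (Finset.mem_univ l)).trans hP
    rw [percLoss, if_neg (hpos l).ne', ← ENNReal.ofReal_toReal hPtop, EReal.coe_ennreal_ofReal,
      max_eq_left ENNReal.toReal_nonneg, EReal.coe_le_coe_iff] at h
    apply mul_exp_neg_le_of_log_div_le (hl l) (hpos l)
    -- Dropping this ratio from the perception bound leaves log (λ / λ̂) ≤ 2 P + 1, the exponent in
    -- `lamHatLower`.
    have : 0 ≤ q.2 l / lam l := div_nonneg (hhat l) (hl l).le
    linarith
  · have := (distLoss_ge (hgam l).1 (hgam l).2 (hhat l)).trans ((Finset.single_le_sum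
      (fun l _ ↦ distLoss_nonneg (hgam l).1 (hgam l).2 (hhat l)) (Finset.mem_univ l)).trans hD)
    simp only
    linarith

lemma pos_of_mem_paramBox (hl : ∀ l, 0 < lam l) {c : ℝ} {q : (Fin L → ℝ) × (Fin L → ℝ)}
    (hq : q ∈ paramBox lam D P c) (l : Fin L) : 0 < q.1 l :=
  (mul_pos (hl l) (Real.exp_pos _)).trans_le (hq.1.1 l)

lemma isCompact_paramBox_inter_feasible (hl : ∀ l, 0 < lam l) (c : ℝ) :
    IsCompact (paramBox lam D P c ∩ feasible lam D P) := by
  have hbox : IsCompact (paramBox lam D P c) := isCompact_Icc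
  have hlow (l : Fin L) : 0 ≤ lamHatLower lam P l := by
    rw [lamHatLower]
    split_ifs
    · exact le_rfl
    · exact (mul_pos (hl l) (Real.exp_pos _)).le
  have hdist : IsClosed {q : (Fin L → ℝ) × (Fin L → ℝ) |
      ∑ l, distLoss (lam l) (q.1 l) (q.2 l) ≤ (D : ℝ)} := by
    refine isClosed_le ?_ continuous_const
    unfold distLoss
    fun_prop
  by_cases hPtop : P = ⊤
  · convert hbox.inter_right hdist using 1
    ext q
    refine ⟨fun h ↦ ⟨h.1, h.2.2.2.1⟩, fun h ↦ ⟨h.1, fun l ↦ ⟨pos_of_mem_paramBox hl h.1 l,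
      h.1.2.1 l⟩, fun l ↦ (hlow l).trans (h.1.1.2 l), h.2, by simp [hPtop]⟩⟩
  · have hpos {q} (hq : q ∈ paramBox lam D P c) (l : Fin L) : 0 < q.2 l := by
      refine lt_of_lt_of_le ?_ (hq.1.2 l)
      simp only [lamHatLower, if_neg hPtop]
      exact mul_pos (hl l) (Real.exp_pos _)
    -- For finite P the box keeps λ̂ away from 0, where the logarithm is discontinuous.
    have hperc : IsClosed (paramBox lam D P c ∩
        (fun q ↦ ∑ l, 1 / 2 * (q.2 l / lam l - 1 + Real.log (lam l / q.2 l))) ⁻¹'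
          Set.Iic P.toReal) := by
      refine ContinuousOn.preimage_isClosed_of_isClosed ?_ hbox.isClosed isClosed_Iic
      refine continuousOn_finsetSum _ fun l _ ↦ ?_
      have h1 : ContinuousOn (fun q : (Fin L → ℝ) × (Fin L → ℝ) ↦ q.2 l)
        (paramBox lam D P c) := by fun_prop
      refine continuousOn_const.mul (((h1.div_const _).sub continuousOn_const).add
        ((continuousOn_const.div h1 fun q hq ↦ (hpos hq l).ne').log
          fun q hq ↦ (div_pos (hl l) (hpos hq l)).ne'))
    convert (hbox.inter_right hdist).inter_right hperc using 1
    ext q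
    refine ⟨fun h ↦ ⟨⟨h.1, h.2.2.2.1⟩, h.1, ?_⟩, fun h ↦ ⟨h.1.1, fun l ↦
      ⟨pos_of_mem_paramBox hl h.1.1 l, h.1.1.2.1 l⟩, fun l ↦ (hpos h.1.1 l).le, h.1.2, ?_⟩⟩
    · exact ((sum_percLoss_le_iff hl h.2.2.1 hPtop).1 h.2.2.2.2).2
    · exact (sum_percLoss_le_iff hl (fun l ↦ (hpos h.1.1 l).le) hPtop).2 ⟨hpos h.1.1, h.2.2⟩

lemma exists_isMinOn_rate (hl : ∀ l, 0 < lam l) (hne : (feasible lam D P).Nonempty) :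
    ∃ q ∈ feasible lam D P, IsMinOn (rate lam) (feasible lam D P) q := by
  obtain ⟨q₀, hq₀⟩ := hne
  have hcont : ContinuousOn (rate lam)
      (paramBox lam D P (rate lam q₀) ∩ feasible lam D P) := by
    refine continuousOn_const.mul (continuousOn_finsetSum _ fun l _ ↦ ?_)
    have h1 : ContinuousOn (fun q : (Fin L → ℝ) × (Fin L → ℝ) ↦ q.1 l)
      (paramBox lam D P (rate lam q₀) ∩ feasible lam D P) := by fun_prop
    exact (continuousOn_const.div h1 fun q hq ↦ (hq.2.1 l).1.ne').log
      fun q hq ↦ (div_pos (hl l) (hq.2.1 l).1).ne'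
  have hmem : q₀ ∈ paramBox lam D P (rate lam q₀) ∩ feasible lam D P :=
    ⟨mem_paramBox hl hq₀ le_rfl, hq₀⟩
  obtain ⟨q, hq, hmin⟩ :=
    (isCompact_paramBox_inter_feasible hl _).exists_isMinOn ⟨q₀, hmem⟩ hcont
  refine ⟨q, hq.2, fun x hx ↦ ?_⟩
  -- A point outside the box has rate above that of q₀, so it cannot beat the minimum over the box.
  rcases le_total (rate lam x) (rate lam q₀) with h | h
  · exact hmin ⟨mem_paramBox hl hx h, hx⟩
  · exact (hmin hmem).trans h

end Minimum

/-! ### Data processing and rotation to the eigenbasis -/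

section Map

variable {E F E' F' : Type*} [MeasurableSpace E] [MeasurableSpace F] [MeasurableSpace E']
  [MeasurableSpace F'] {f : E → E'} {g : F → F'}

lemma fst_map_prodMap (π : Measure (E × F)) (hf : Measurable f) (hg : Measurable g) :
    (π.map (Prod.map f g)).fst = π.fst.map f := by
  rw [Measure.fst, Measure.map_map measurable_fst (hf.prodMap hg), Measure.fst,
    Measure.map_map hf measurable_fst]
  rfl

lemma snd_map_prodMap (π : Measure (E × F)) (hf : Measurable f) (hg : Measurable g) :
    (π.map (Prod.map f g)).snd = π.snd.map g := by
  rw [Measure.snd, Measure.map_map measurable_snd (hf.prodMap hg), Measure.snd,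
    Measure.map_map hg measurable_snd]
  rfl

lemma mutualInfo_map_le (π : Measure (E × F)) [IsProbabilityMeasure π] (hf : Measurable f)
    (hg : Measurable g) : mutualInfo (π.map (Prod.map f g)) ≤ mutualInfo π := by
  rw [mutualInfo, fst_map_prodMap π hf hg, snd_map_prodMap π hf hg,
    Measure.map_prod_map _ _ hf hg]
  exact klDiv_map_le _ _ (hf.prodMap hg)

end Map

section Coordinates

variable {L : ℕ} {Θ : Matrix (Fin L) (Fin L) ℝ}

/-- The vector with coordinates `z` in the orthonormal basis given by the rows of `Θ`. -/
noncomputable def ofCoords (Θ : Matrix (Fin L) (Fin L) ℝ) (z : Fin L → ℝ) :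
    EuclideanSpace ℝ (Fin L) :=
  WithLp.toLp 2 (Θᵀ *ᵥ z)

/-- The coordinates of `x` in the orthonormal basis given by the rows of `Θ`. -/
noncomputable def coords (Θ : Matrix (Fin L) (Fin L) ℝ) (x : EuclideanSpace ℝ (Fin L)) :
    Fin L → ℝ :=
  Θ *ᵥ x.ofLp

@[fun_prop]
lemma measurable_ofCoords : Measurable (ofCoords Θ) := by
  have : Continuous (ofCoords Θ) := by unfold ofCoords; fun_prop
  exact this.measurable

@[fun_prop]
lemma measurable_coords : Measurable (coords Θ) := by
  have : Continuous (coords Θ) := by unfold coords; fun_prop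
  exact this.measurable

lemma coords_ofCoords (hΘ : Θ ∈ Matrix.orthogonalGroup (Fin L) ℝ) (z : Fin L → ℝ) :
    coords Θ (ofCoords Θ z) = z := by
  have : Θ * Θᵀ = 1 := (Matrix.mem_orthogonalGroup_iff _ _).1 hΘ
  simp [coords, ofCoords, this]

lemma ofCoords_coords (hΘ : Θ ∈ Matrix.orthogonalGroup (Fin L) ℝ)
    (x : EuclideanSpace ℝ (Fin L)) : ofCoords Θ (coords Θ x) = x := by
  have : Θᵀ * Θ = 1 := (Matrix.mem_orthogonalGroup_iff' _ _).1 hΘ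
  simp [coords, ofCoords, this]

lemma enorm_sq_ofCoords_sub (hΘ : Θ ∈ Matrix.orthogonalGroup (Fin L) ℝ) (z w : Fin L → ℝ) :
    ‖ofCoords Θ z - ofCoords Θ w‖ₑ ^ 2 = ∑ l, ‖z l - w l‖ₑ ^ 2 := by
  have hsub : ofCoords Θ z - ofCoords Θ w = WithLp.toLp 2 (Θᵀ *ᵥ (z - w)) := by
    simp [ofCoords, Matrix.mulVec_sub]
  have h : Θ * Θᵀ = 1 := (Matrix.mem_orthogonalGroup_iff _ _).1 hΘ
  have h2 : ‖ofCoords Θ z - ofCoords Θ w‖ ^ 2 = ∑ l, (z l - w l) ^ 2 := by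
    rw [hsub, EuclideanSpace.real_norm_sq_eq]
    have : (Θᵀ *ᵥ (z - w)) ⬝ᵥ (Θᵀ *ᵥ (z - w)) = (z - w) ⬝ᵥ (z - w) := by
      rw [Matrix.dotProduct_mulVec, Matrix.vecMul_transpose, Matrix.mulVec_mulVec, h,
        Matrix.one_mulVec]
    simpa [dotProduct, sq] using this
  simp_rw [enorm_sq_eq_ofReal_sq]
  rw [← ENNReal.ofReal_sum_of_nonneg fun l _ ↦ sq_nonneg _, ← h2, ← ofReal_norm,
    ENNReal.ofReal_pow (norm_nonneg _)]

/-- Comparison of characteristic functions: Θᵀ moves to the other side of the inner product, and the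
quadratic form of S becomes diagonal. -/
lemma map_ofCoords_pi_gaussianReal {S : Matrix (Fin L) (Fin L) ℝ} (hS : S.PosSemidef)
    {lam : Fin L → ℝ≥0} (hdec : S = Θᵀ * Matrix.diagonal (fun l ↦ (lam l : ℝ)) * Θ) :
    (Measure.pi fun l ↦ gaussianReal 0 (lam l)).map (ofCoords Θ) = multivariateGaussian 0 S := by
  have : IsProbabilityMeasure ((Measure.pi fun l ↦ gaussianReal 0 (lam l)).map (ofCoords Θ)) :=
    Measure.isProbabilityMeasure_map (by fun_prop)
  refine Measure.ext_of_charFun ?_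
  ext t
  have h1 : charFun ((Measure.pi fun l ↦ gaussianReal 0 (lam l)).map (ofCoords Θ)) t =
      charFun ((Measure.pi fun l ↦ gaussianReal 0 (lam l)).map (WithLp.toLp 2))
        (WithLp.toLp 2 (Θ *ᵥ t.ofLp)) := by
    rw [charFun_apply, charFun_apply, integral_map (by fun_prop) (by fun_prop),
      integral_map (by fun_prop) (by fun_prop)]
    congr with z
    congr 3
    simp only [EuclideanSpace.inner_eq_star_dotProduct, ofCoords, star_trivial]
    rw [Matrix.dotProduct_mulVec, Matrix.vecMul_transpose]
  rw [h1, charFun_pi, charFun_multivariateGaussian hS, hdec]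
  simp only [charFun_gaussianReal, ← Complex.exp_sum]
  congr 1
  have h2 : t.ofLp ⬝ᵥ (Θᵀ * Matrix.diagonal (fun l ↦ (lam l : ℝ)) * Θ) *ᵥ t.ofLp =
      ∑ l, lam l * (Θ *ᵥ t.ofLp) l ^ 2 := by
    rw [← Matrix.mulVec_mulVec, ← Matrix.mulVec_mulVec, Matrix.dotProduct_mulVec,
      Matrix.vecMul_transpose]
    simp only [dotProduct, Matrix.mulVec_diagonal]
    exact Finset.sum_congr rfl fun l _ ↦ by ring
  rw [h2]
  simp [Finset.sum_div, Finset.sum_neg_distrib]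

end Coordinates

/-! ### Transport of both bounds to the original coordinates -/

section Transport

variable {L : ℕ} {Θ S : Matrix (Fin L) (Fin L) ℝ} {lam : Fin L → ℝ≥0} {D : ℝ≥0} {P : ℝ≥0∞}

lemma exists_feasible_of_admissible (hS : S.PosSemidef)
    (hΘ : Θ ∈ Matrix.orthogonalGroup (Fin L) ℝ)
    (hdec : S = Θᵀ * Matrix.diagonal (fun l ↦ (lam l : ℝ)) * Θ) (hl : ∀ l, lam l ≠ 0)
    {κ : Kernel (EuclideanSpace ℝ (Fin L)) (EuclideanSpace ℝ (Fin L))}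
    (hκ : κ ∈ admissible (multivariateGaussian 0 S) D P)
    (hI : mutualInfo (multivariateGaussian 0 S ⊗ₘ κ) ≠ ⊤) :
    ∃ q ∈ feasible (fun l ↦ (lam l : ℝ)) D P, ENNReal.ofReal (rate (fun l ↦ (lam l : ℝ)) q) ≤
      mutualInfo (multivariateGaussian 0 S ⊗ₘ κ) := by
  obtain ⟨hmarkov, hD, hP⟩ := hκ
  have hc : Measurable (coords Θ) := measurable_coords
  have hcc := hc.prodMap hc
  set PX := multivariateGaussian 0 S with hPX
  have hlaw : PX.map (coords Θ) = Measure.pi fun l ↦ gaussianReal 0 (lam l) := by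
    rw [hPX, ← map_ofCoords_pi_gaussianReal hS hdec, Measure.map_map hc (by fun_prop)]
    convert Measure.map_id
    ext1 z
    exact coords_ofCoords hΘ z
  have hprob : IsProbabilityMeasure ((PX ⊗ₘ κ).map (Prod.map (coords Θ) (coords Θ))) :=
    Measure.isProbabilityMeasure_map hcc.aemeasurable
  have hmi := mutualInfo_map_le (PX ⊗ₘ κ) hc hc
  obtain ⟨q, hq, hr⟩ := exists_feasible_of_coupling hl (D := D) (P := P)
    (π := (PX ⊗ₘ κ).map (Prod.map (coords Θ) (coords Θ)))
    (by rw [fst_map_prodMap _ hc hc, Measure.fst_compProd, hlaw])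
    (by
      rw [lintegral_map (by fun_prop) hcc]
      refine le_of_eq_of_le (lintegral_congr fun p ↦ ?_) hD
      rw [← enorm_sq_ofCoords_sub hΘ]
      simp [ofCoords_coords hΘ])
    (by
      rw [snd_map_prodMap _ hc hc, Measure.snd_compProd, ← hlaw]
      exact (klDiv_map_le _ _ hc).trans hP)
    (ne_top_of_le_ne_top hI hmi)
  exact ⟨q, hq, ((ENNReal.ofReal_le_ofReal hr).trans ENNReal.ofReal_toReal_le).trans hmi⟩

lemma rdpFunction_le_of_feasible (hS : S.PosSemidef)
    (hΘ : Θ ∈ Matrix.orthogonalGroup (Fin L) ℝ)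
    (hdec : S = Θᵀ * Matrix.diagonal (fun l ↦ (lam l : ℝ)) * Θ) (hl : ∀ l, lam l ≠ 0)
    {q : (Fin L → ℝ) × (Fin L → ℝ)} (hq : q ∈ feasible (fun l ↦ (lam l : ℝ)) D P) :
    rdpFunction (multivariateGaussian 0 S) D P ≤
      ENNReal.ofReal (rate (fun l ↦ (lam l : ℝ)) q) := by
  obtain ⟨π, hπ, hfst, hD, hP, hI⟩ := exists_coupling_of_feasible hl hq
  have hc : Measurable (ofCoords Θ) := measurable_ofCoords
  have hcc := hc.prodMap hc
  have hlaw := map_ofCoords_pi_gaussianReal hS hdec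
  set ρ := π.map (Prod.map (ofCoords Θ) (ofCoords Θ)) with hρ
  have hprob : IsProbabilityMeasure ρ := Measure.isProbabilityMeasure_map hcc.aemeasurable
  have hρfst : ρ.fst = multivariateGaussian 0 S := by
    rw [hρ, fst_map_prodMap _ hc hc, hfst, hlaw]
  -- Disintegration turns the joint law into a conditional law given the source.
  have hcomp : multivariateGaussian 0 S ⊗ₘ ρ.condKernel = ρ := by
    rw [← hρfst]; exact ρ.disintegrate ρ.condKernel
  refine (iInf₂_le ρ.condKernel ⟨inferInstance, ?_, ?_⟩).trans ?_
  · rw [hcomp]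
    exact (mutualInfo_map_le π hc hc).trans hI
  · rw [hcomp, hρ, lintegral_map (by fun_prop) hcc]
    refine le_of_eq_of_le (lintegral_congr fun p ↦ ?_) hD
    exact enorm_sq_ofCoords_sub hΘ _ _
  · rw [← Measure.snd_compProd, hcomp, hρ, snd_map_prodMap _ hc hc, ← hlaw]
    exact (klDiv_map_le _ _ hc).trans hP

end Transport

/-- The diagonal matrix is Θ S Θᵀ, congruent to S by an invertible matrix. -/
lemma pos_of_posDef_eq {L : ℕ} {Θ S : Matrix (Fin L) (Fin L) ℝ} (hS : S.PosDef)
    (hΘ : Θ ∈ Matrix.orthogonalGroup (Fin L) ℝ) {lam : Fin L → ℝ}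
    (hdec : S = Θᵀ * Matrix.diagonal lam * Θ) (l : Fin L) : 0 < lam l := by
  have h : Θ * Θᵀ = 1 := (Matrix.mem_orthogonalGroup_iff _ _).1 hΘ
  have h1 : Matrix.diagonal lam = Θ * S * Θᵀ := by
    rw [hdec]
    simp only [Matrix.mul_assoc, h, Matrix.mul_one]
    rw [← Matrix.mul_assoc, h, Matrix.one_mul]
  have h2 : (Θ * S * Θᵀ).PosDef := by
    have := hS.mul_mul_conjTranspose_same (B := Θ)
      (Matrix.vecMul_injective_of_isUnit (IsUnit.of_mul_eq_one _ h))
    simpa using this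
  rw [← h1, Matrix.posDef_diagonal_iff] at h2
  exact h2 l

end RDP

theorem theorem3 {L : ℕ} (S : Matrix (Fin L) (Fin L) ℝ) (hS : S.PosDef)
    (Θ : Matrix (Fin L) (Fin L) ℝ) (hΘ : Θ ∈ Matrix.orthogonalGroup (Fin L) ℝ)
    (lam : Fin L → ℝ) (hdec : S = Θᵀ * Matrix.diagonal lam * Θ)
    (D : ℝ≥0) (P : ℝ≥0∞) :
    (0 < D → (RDP.feasible lam D P).Nonempty) ∧
    ((RDP.feasible lam D P).Nonempty →
      ∃ q ∈ RDP.feasible lam D P,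
        IsMinOn (RDP.rate lam) (RDP.feasible lam D P) q ∧
        (RDP.rdpFunction (multivariateGaussian 0 S) D P : EReal) = (RDP.rate lam q : EReal)) ∧
    (RDP.feasible lam D P = ∅ → RDP.rdpFunction (multivariateGaussian 0 S) D P = ⊤) := by
  have hpos := RDP.pos_of_posDef_eq hS hΘ hdec
  lift lam to Fin L → ℝ≥0 using fun l ↦ (hpos l).le
  have hl (l : Fin L) : lam l ≠ 0 := fun h ↦ (hpos l).ne' (by simp [h])
  refine ⟨RDP.feasible_nonempty hpos, fun hne ↦ ?_, fun hempty ↦ ?_⟩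
  · obtain ⟨q, hq, hmin⟩ := RDP.exists_isMinOn_rate hpos hne
    refine ⟨q, hq, hmin, ?_⟩
    have heq : RDP.rdpFunction (multivariateGaussian 0 S) D P =
        ENNReal.ofReal (RDP.rate (fun l ↦ (lam l : ℝ)) q) := by
      refine le_antisymm (RDP.rdpFunction_le_of_feasible hS.posSemidef hΘ hdec hl hq) ?_
      refine le_iInf₂ fun κ hκ ↦ ?_
      by_cases hI : RDP.mutualInfo (multivariateGaussian 0 S ⊗ₘ κ) = ⊤
      · simp [hI]
      obtain ⟨q', hq', hr⟩ :=
        RDP.exists_feasible_of_admissible hS.posSemidef hΘ hdec hl hκ hI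
      exact (ENNReal.ofReal_le_ofReal (hmin hq')).trans hr
    rw [heq, EReal.coe_ennreal_ofReal, max_eq_left (RDP.rate_nonneg hq)]
  · refine iInf₂_eq_top.2 fun κ hκ ↦ ?_
    -- An admissible kernel of finite information would produce a feasible point.
    by_contra hI
    obtain ⟨q, hq, -⟩ := RDP.exists_feasible_of_admissible hS.posSemidef hΘ hdec hl hκ hI
    exact Set.notMem_empty q (hempty ▸ hq)
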